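/- **Gluing state designs with phase operators.** For a finite set $Q$ of qubits, an *ensemble* on $Q$ is a probability measure $\mathcal S$ on the unit sphere of $\mathbb C^{2^{|Q|}}$ (pure states), with $k$-th moment $\chi_{\mathcal S}=\mathbb E_{\phi\sim\mathcal S}\,(|\phi\rangle\langle\phi|)^{\otimes k}$; $\mathcal S$ is an *$\varepsilon$-approximate state $k$-design* if $\|\chi_{\mathcal S}-\chi_H\|_1\le\varepsilon$, where $\chi_H$ is the $k$-th moment of the Haar (uniform) measure on the unit sphere and $\|\cdot\|_1$ is the trace norm (sum of the singular values). There is an absolute constant $C>0$ with the following property. Let $k,\xi\ge 0$ be integers, let $A,B$ be disjoint finite sets of qubits with $|A|,|B|\ge\xi$, and choose $\Xi_A\subseteq A$, $\Xi_B\subseteq B$ with $|\Xi_A|=|\Xi_B|=\xi$. Let $\mathcal S_A$, $\mathcal S_B$ be $\varepsilon_A$- and $\varepsilon_B$-approximate state $k$-designs on $A$ and $B$. Let $f$ be a random Boolean function on $\{0,1\}^{\Xi_A\sqcup\Xi_B}$ that is $2k$-wise independent, i.e. $\Pr[f(x_1)=y_1,\dots,f(x_{2k})=y_{2k}]=2^{-2k}$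 for all distinct inputs $x_1,\dots,x_{2k}$ and all bits $y_1,\dots,y_{2k}$ (for example, a uniformly random function), and let $F_f=\sum_z(-1)^{f(z)}|z\rangle\langle z|$ be the corresponding phase operator on $\Xi_A\sqcup\Xi_B$. Then the ensemble of states $(F_f\otimes \mathbb 1)(|\phi_A\rangle\otimes|\phi_B\rangle)$ on $A\sqcup B$, with $\phi_A\sim\mathcal S_A$, $\phi_B\sim\mathcal S_B$ and $f$ independent, is an $\varepsilon$-approximate state $k$-design with $$\varepsilon=\varepsilon_A+\varepsilon_B+C\,\frac{k^2}{2^{\xi}} .$$ No relation between $k$ and $\xi$ is required; in particular the bound holds in the regime $k=o(2^{\xi/2})$. -/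

import Mathlib

open MeasureTheory

noncomputable section

namespace QDesign

/-- Bitstrings on the qubits `Q`; they label the computational basis of `Q`. -/
abbrev Bits (Q : Type) : Type := Q → Bool

/-- Pure states of the qubits `Q`: unit vectors of `ℂ^{2^|Q|}`. -/
abbrev PureState (Q : Type) [Fintype Q] [DecidableEq Q] : Type :=
  Metric.sphere (0 : EuclideanSpace ℂ (Bits Q)) 1

/-- The trace norm `‖M‖₁ = Tr √(Mᴴ M)`: the sum of the singular values of `M`. -/
def traceNorm {ι : Type} [Fintype ι] [DecidableEq ι] (M : Matrix ι ι ℂ) : ℝ :=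
  ∑ i, √((Matrix.isHermitian_conjTranspose_mul_self M).eigenvalues i)

section Ensembles

variable {Q : Type} [Fintype Q] [DecidableEq Q]

/-- The rank-one projector `|φ⟩⟨φ|`. -/
def projector (φ : PureState Q) : Matrix (Bits Q) (Bits Q) ℂ :=
  Matrix.of fun x y => φ.1 x * star (φ.1 y)

/-- The `k`-fold tensor power `ρ^{⊗k}` on `k` copies, in the computational basis. -/
def tensorPower (k : ℕ) (ρ : Matrix (Bits Q) (Bits Q) ℂ) :
    Matrix (Fin k → Bits Q) (Fin k → Bits Q) ℂ :=
  Matrix.of fun x y => ∏ j, ρ (x j) (y j)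

/-- The `k`-th moment `χ_S = 𝔼_{φ ∼ S} (|φ⟩⟨φ|)^{⊗k}` of an ensemble of pure states
(the expectation is taken entrywise). -/
def moment (k : ℕ) (S : Measure (PureState Q)) :
    Matrix (Fin k → Bits Q) (Fin k → Bits Q) ℂ :=
  Matrix.of fun x y => ∫ φ, tensorPower k (projector φ) x y ∂S

variable (Q) in
/-- The Haar ensemble: the uniform probability measure on the unit sphere of `ℂ^{2^|Q|}`. -/
def haarEnsemble : Measure (PureState Q) :=
  ((volume : Measure (EuclideanSpace ℂ (Bits Q))).toSphere Set.univ)⁻¹ •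
    (volume : Measure (EuclideanSpace ℂ (Bits Q))).toSphere

instance haarEnsemble.instIsProbabilityMeasure :
    IsProbabilityMeasure (haarEnsemble Q) := by
  have : NeZero ((volume : Measure (EuclideanSpace ℂ (Bits Q))).toSphere) :=
    ⟨Measure.toSphere_ne_zero _⟩
  exact isProbabilityMeasureSMul

/-- `S` is an `ε`-approximate state `k`-design: `‖χ_S - χ_H‖₁ ≤ ε`. -/
def IsApproxStateDesign (k : ℕ) (ε : ℝ) (S : Measure (PureState Q)) : Prop :=
  traceNorm (moment k S - moment k (haarEnsemble Q)) ≤ ε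

end Ensembles

/-- A random Boolean function on `X`, with law `ν`, is `t`-wise independent: its values at any `t`
distinct inputs are independent and uniform. -/
def IsWiseIndependent {X : Type} (t : ℕ) (ν : Measure (X → Bool)) : Prop :=
  ∀ x : Fin t → X, Function.Injective x → ∀ y : Fin t → Bool,
    ν.real {f | ∀ i, f (x i) = y i} = ((2 : ℝ) ^ t)⁻¹

section Gluing

variable {A B : Type} [Fintype A] [DecidableEq A] [Fintype B] [DecidableEq B]

/-- The restriction of a bitstring on `A ⊔ B` to the qubits `ΞA ⊔ ΞB`. -/
def restrictBits (ΞA : Finset A) (ΞB : Finset B) (z : Bits (A ⊕ B)) : Bits (ΞA ⊕ ΞB) :=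
  fun q => z (Sum.map Subtype.val Subtype.val q)

/-- The product state `|φ⟩ ⊗ |ψ⟩` on `A ⊔ B`. -/
def tensorState (φ : PureState A) (ψ : PureState B) : PureState (A ⊕ B) :=
  ⟨WithLp.toLp 2 fun z : Bits (A ⊕ B) => φ.1 (z ∘ Sum.inl) * ψ.1 (z ∘ Sum.inr), by
    have hφ : ∑ x, ‖φ.1 x‖ ^ 2 = 1 := by
      rw [← EuclideanSpace.norm_sq_eq, norm_eq_of_mem_sphere]; norm_num
    have hψ : ∑ x, ‖ψ.1 x‖ ^ 2 = 1 := by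
      rw [← EuclideanSpace.norm_sq_eq, norm_eq_of_mem_sphere]; norm_num
    rw [mem_sphere_zero_iff_norm, EuclideanSpace.norm_eq, Real.sqrt_eq_one]
    simp only [norm_mul, mul_pow]
    rw [← (Equiv.sumArrowEquivProdArrow A B Bool).symm.sum_comp, Fintype.sum_prod_type]
    calc _ = ∑ x : Bits A, ∑ y : Bits B, ‖φ.1 x‖ ^ 2 * ‖ψ.1 y‖ ^ 2 := rfl
      _ = 1 := by simp_rw [← Finset.mul_sum, hψ, mul_one, hφ]⟩

/-- The phase operator `F_f = ∑_z (-1)^{f(z)} |z⟩⟨z|` of a Boolean function `f` of the bits on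
`ΞA ⊔ ΞB`, tensored with the identity on the other qubits and applied to a state on `A ⊔ B`. -/
def applyPhase (ΞA : Finset A) (ΞB : Finset B) (f : Bits (ΞA ⊕ ΞB) → Bool)
    (φ : PureState (A ⊕ B)) : PureState (A ⊕ B) :=
  ⟨WithLp.toLp 2 fun z : Bits (A ⊕ B) => (-1) ^ (f (restrictBits ΞA ΞB z)).toNat * φ.1 z, by
    have h : ‖φ.1‖ = 1 := norm_eq_of_mem_sphere φ
    rw [EuclideanSpace.norm_eq] at h
    rw [mem_sphere_zero_iff_norm, EuclideanSpace.norm_eq]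
    simpa using h⟩

/-- The ensemble of the states `F_f (|φ⟩ ⊗ |ψ⟩)`, where `φ ∼ SA`, `ψ ∼ SB` and the Boolean
function `f ∼ ν` are independent. -/
def gluedEnsemble (ΞA : Finset A) (ΞB : Finset B) (SA : Measure (PureState A))
    (SB : Measure (PureState B)) (ν : Measure (Bits (ΞA ⊕ ΞB) → Bool)) :
    Measure (PureState (A ⊕ B)) :=
  ((SA.prod SB).prod ν).map fun p => applyPhase ΞA ΞB p.2 (tensorState p.1.1 p.1.2)

/-- The map that defines the glued ensemble is measurable. -/
theorem measurable_glue (ΞA : Finset A) (ΞB : Finset B) :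
    Measurable fun p : (PureState A × PureState B) × (Bits (ΞA ⊕ ΞB) → Bool) =>
      applyPhase ΞA ΞB p.2 (tensorState p.1.1 p.1.2) := by
  refine Measurable.subtype_mk ?_
  refine (WithLp.measurable_toLp 2 _).comp (measurable_pi_lambda _ fun z => ?_)
  refine Measurable.mul ?_ (Measurable.mul ?_ ?_)
  · exact (measurable_of_countable fun b : Bool => ((-1 : ℂ)) ^ b.toNat).comp
      ((measurable_pi_apply _).comp measurable_snd)
  · exact (by fun_prop : Continuous fun φ : PureState A => φ.1 (z ∘ Sum.inl)).measurable.comp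
      (measurable_fst.comp measurable_fst)
  · exact (by fun_prop : Continuous fun φ : PureState B => φ.1 (z ∘ Sum.inr)).measurable.comp
      (measurable_snd.comp measurable_fst)

instance gluedEnsemble.instIsProbabilityMeasure (ΞA : Finset A) (ΞB : Finset B)
    (SA : Measure (PureState A)) [IsProbabilityMeasure SA]
    (SB : Measure (PureState B)) [IsProbabilityMeasure SB]
    (ν : Measure (Bits (ΞA ⊕ ΞB) → Bool)) [IsProbabilityMeasure ν] :
    IsProbabilityMeasure (gluedEnsemble ΞA ΞB SA SB ν) :=
  Measure.isProbabilityMeasure_map (measurable_glue ΞA ΞB).aemeasurable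

end Gluing

end QDesign

end

namespace QDesign

set_option linter.unusedSectionVars false

open scoped Matrix ComplexOrder

/-! ### Trace norm through differences of positive semidefinite matrices. -/

section TraceNorm

variable {ι : Type} [Fintype ι]

/-! The phase operator is diagonal, so averaging over `f` multiplies the product of the two moments
entrywise by a matrix of expected signs (`moment_gluedEnsemble`). That sign matrix is positive
semidefinite with unit diagonal. By the Schur product theorem, gluing therefore preserves positivity
and multiplies traces. Errors in the two input moments pass through without growing, and two
triangle inequalities reduce the claim to Haar inputs, at cost `εA + εB`.

For Haar inputs, call a `k`-tuple of bitstrings locally distinct if its restrictions to `ΞA` are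
distinct and those to `ΞB` are too. Phase invariance makes a Haar moment entry vanish unless its
indices agree up to a permutation. The product of the Haar moments thus relates tuples whose
`A`-parts differ by some `σ` and whose `B`-parts differ by an independent `τ`. On locally distinct
tuples, `2k`-wise independence kills the entry unless both tuples have the same set of restrictions
to `ΞA ⊔ ΞB`, and this forces `σ = τ` (`IsLocallyDistinct.eq_comp_perm`). On this block the glued
moment and the global Haar moment are hence multiples of one matrix, `distinctMatrix`, and neither
has entries linking the block to its complement.

Both have trace one, so only the diagonal weight off the block matters
(`IsTraceBounded.of_proportional_block`). It is a collision probability, bounded by a union bound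
over pairs of copies and the Haar fourth moments (`sum_collision_moment_haar_le`). -/

theorem traceNorm_eq_sum_abs_eigenvalues [DecidableEq ι] {M : Matrix ι ι ℂ} (hM : M.IsHermitian) :
    traceNorm M = ∑ i, |hM.eigenvalues i| := by
  have hM2 := Matrix.isHermitian_conjTranspose_mul_self M
  -- The eigenvalues of `Mᴴ * M` and the squared eigenvalues of `M` are compared as multisets of
  -- roots of one characteristic polynomial, which avoids matching their orderings.
  have hcfc : Mᴴ * M = cfc (fun x : ℝ => x ^ 2) M := by
    rw [cfc_pow_id (R := ℝ) M 2 hM.isSelfAdjoint, hM.eq, pow_two]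
  have hroots := hM2.roots_charpoly_eq_eigenvalues
  have hch := hM.charpoly_cfc_eq (fun x : ℝ => x ^ 2)
  rw [← hcfc] at hch
  have hr2 : (Mᴴ * M).charpoly.roots =
      Finset.univ.val.map fun i => ((hM.eigenvalues i ^ 2 : ℝ) : ℂ) := by
    rw [hch, Polynomial.roots_prod _ _ (Finset.prod_ne_zero_iff.2 fun i _ =>
      Polynomial.X_sub_C_ne_zero _)]
    simp only [Polynomial.roots_X_sub_C, Multiset.bind_singleton]
    rfl
  have h := congrArg (fun s : Multiset ℂ => (s.map fun z => √z.re).sum) (hroots.symm.trans hr2)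
  simpa [Multiset.map_map, Function.comp_def, Real.sqrt_sq_eq_abs, traceNorm,
    ← Complex.ofReal_pow] using h

/-- `M` is a difference of positive semidefinite matrices of total trace at most `t`. -/
def IsTraceBounded (M : Matrix ι ι ℂ) (t : ℝ) : Prop :=
  ∃ P N : Matrix ι ι ℂ, P.PosSemidef ∧ N.PosSemidef ∧ M = P - N ∧ P.trace.re + N.trace.re ≤ t

theorem IsTraceBounded.add {M N : Matrix ι ι ℂ} {s t : ℝ} (hM : IsTraceBounded M s)
    (hN : IsTraceBounded N t) : IsTraceBounded (M + N) (s + t) := by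
  obtain ⟨P, P', hP, hP', rfl, h⟩ := hM
  obtain ⟨R, R', hR, hR', rfl, h'⟩ := hN
  refine ⟨P + R, P' + R', hP.add hR, hP'.add hR', by abel, ?_⟩
  simp only [Matrix.trace_add, Complex.add_re]
  linarith

theorem IsTraceBounded.mono {M : Matrix ι ι ℂ} {s t : ℝ} (hM : IsTraceBounded M s)
    (h : s ≤ t) : IsTraceBounded M t := by
  obtain ⟨P, P', hP, hP', rfl, h'⟩ := hM
  exact ⟨P, P', hP, hP', rfl, h'.trans h⟩

theorem IsTraceBounded.of_posSemidef {M : Matrix ι ι ℂ} (hM : M.PosSemidef) :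
    IsTraceBounded M M.trace.re :=
  ⟨M, 0, hM, .zero, by simp, by simp⟩

theorem IsTraceBounded.sub_of_posSemidef {M N : Matrix ι ι ℂ} (hM : M.PosSemidef)
    (hN : N.PosSemidef) : IsTraceBounded (M - N) (M.trace.re + N.trace.re) :=
  ⟨M, N, hM, hN, rfl, le_rfl⟩

/-- In an eigenbasis of `P - N` each eigenvalue is a difference of nonnegative diagonal entries of
`P` and `N`, so its absolute value is at most their sum; these sums add up to the two traces. -/
theorem IsTraceBounded.traceNorm_le [DecidableEq ι] {M : Matrix ι ι ℂ} {t : ℝ} (h : IsTraceBounded M t) :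
    traceNorm M ≤ t := by
  obtain ⟨P, N, hP, hN, rfl, ht⟩ := h
  have hM : (P - N).IsHermitian := hP.1.sub hN.1
  rw [traceNorm_eq_sum_abs_eigenvalues hM]
  refine le_trans ?_ ht
  set U : Matrix ι ι ℂ := (hM.eigenvectorUnitary : Matrix ι ι ℂ) with hU
  have hUU : U * Uᴴ = 1 := Unitary.coe_mul_star_self hM.eigenvectorUnitary
  have htr (X : Matrix ι ι ℂ) : (Uᴴ * X * U).trace = X.trace := by
    rw [Matrix.trace_mul_cycle, hUU, one_mul]
  have hdiag : Uᴴ * (P - N) * U = Matrix.diagonal (RCLike.ofReal ∘ hM.eigenvalues) := by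
    have := hM.conjStarAlgAut_star_eigenvectorUnitary
    rwa [Unitary.conjStarAlgAut_star_apply] at this
  have hP' := hP.conjTranspose_mul_mul_same U
  have hN' := hN.conjTranspose_mul_mul_same U
  rw [← htr P, ← htr N, Matrix.trace, Matrix.trace, Complex.re_sum, Complex.re_sum,
    ← Finset.sum_add_distrib]
  refine Finset.sum_le_sum fun i _ => ?_
  have h1 : hM.eigenvalues i = ((Uᴴ * P * U) i i).re - ((Uᴴ * N * U) i i).re := by
    have := congrArg (fun X : Matrix ι ι ℂ => (X i i).re) hdiag
    simpa [mul_sub, sub_mul] using this.symm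
  have h2 := (Complex.le_def.1 (hP'.diag_nonneg (i := i))).1
  have h3 := (Complex.le_def.1 (hN'.diag_nonneg (i := i))).1
  simp only [Complex.zero_re] at h2 h3
  rw [h1, Matrix.diag_apply, Matrix.diag_apply, abs_le]
  constructor <;> linarith

/-- The witnesses are the spectral positive and negative parts. With the converse above, the trace
norm of a Hermitian matrix can be handled through decompositions alone. -/
theorem isTraceBounded_of_traceNorm_le [DecidableEq ι] {M : Matrix ι ι ℂ} (hM : M.IsHermitian) {t : ℝ}
    (h : traceNorm M ≤ t) : IsTraceBounded M t := by
  rw [traceNorm_eq_sum_abs_eigenvalues hM] at h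
  set U : Matrix ι ι ℂ := (hM.eigenvectorUnitary : Matrix ι ι ℂ) with hU
  have hUU : Uᴴ * U = 1 := Unitary.coe_star_mul_self hM.eigenvectorUnitary
  have key (d : ι → ℝ) (hd : ∀ i, 0 ≤ d i) :
      (U * Matrix.diagonal (fun i => (d i : ℂ)) * Uᴴ).PosSemidef ∧
      (U * Matrix.diagonal (fun i => (d i : ℂ)) * Uᴴ).trace.re = ∑ i, d i := by
    constructor
    · refine Matrix.PosSemidef.mul_mul_conjTranspose_same ?_ U
      exact Matrix.PosSemidef.diagonal fun i => by simpa using hd i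
    · rw [Matrix.trace_mul_cycle, hUU, one_mul, Matrix.trace_diagonal, Complex.re_sum]
      simp
  have hp := key (fun i => (hM.eigenvalues i)⁺) fun i => posPart_nonneg _
  have hn := key (fun i => (hM.eigenvalues i)⁻) fun i => negPart_nonneg _
  refine ⟨_, _, hp.1, hn.1, ?_, ?_⟩
  · rw [← sub_mul, ← mul_sub, Matrix.diagonal_sub]
    conv_lhs => rw [hM.spectral_theorem, Unitary.conjStarAlgAut_apply]
    congr 3
    ext i
    rw [← Complex.ofReal_sub, posPart_sub_negPart]
    rfl
  · rw [hp.2, hn.2, ← Finset.sum_add_distrib]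
    simpa [posPart_add_negPart] using h

end TraceNorm

/-! ### Haar moments from the symmetries of the sphere. -/

noncomputable section Haar

variable {Q : Type} [Fintype Q] [DecidableEq Q]

theorem integrable_of_continuous {E : Type*} [NormedAddCommGroup E] [MeasurableSpace E]
    [BorelSpace E] [SecondCountableTopology E] {X : Type*}
    [TopologicalSpace X] [CompactSpace X] [MeasurableSpace X] [OpensMeasurableSpace X]
    (μ : Measure X) [IsFiniteMeasure μ] {f : X → E}
    (hf : Continuous f) : Integrable f μ :=
  (BoundedContinuousFunction.mkOfCompact ⟨f, hf⟩).integrable μ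

open scoped Pointwise in
-- Up to a constant, the sphere measure of `s` is the volume of the cone `(0,1) • s`, and a linear
-- isometry carries cones to cones and preserves volume.
theorem haarEnsemble_integral_comp {F : Type*} [NormedAddCommGroup F] [NormedSpace ℝ F]
    [SecondCountableTopology F]
    (U : EuclideanSpace ℂ (Bits Q) ≃ₗᵢ[ℝ] EuclideanSpace ℂ (Bits Q))
    {f : EuclideanSpace ℂ (Bits Q) → F} (hf : Continuous f) :
    ∫ φ, f (U φ.1) ∂haarEnsemble Q = ∫ φ, f φ.1 ∂haarEnsemble Q := by
  let V : PureState Q → PureState Q := fun φ => ⟨U φ.1, by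
    rw [mem_sphere_zero_iff_norm, U.norm_map, norm_eq_of_mem_sphere]⟩
  have hV : Continuous V := by fun_prop
  have hmap : (haarEnsemble Q).map V = haarEnsemble Q := by
    rw [haarEnsemble, Measure.map_smul]
    congr 1
    ext s hs
    rw [Measure.map_apply hV.measurable hs, Measure.toSphere_apply' _ hs,
      Measure.toSphere_apply' _ (hV.measurable hs)]
    congr 1
    have hset : Set.Ioo (0 : ℝ) 1 • (Subtype.val '' (V ⁻¹' s)) =
        U ⁻¹' (Set.Ioo (0 : ℝ) 1 • (Subtype.val '' s)) := by
      ext v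
      simp only [Set.mem_smul, Set.mem_image, Set.mem_preimage]
      constructor
      · rintro ⟨r, hr, _, ⟨φ, hφ, rfl⟩, rfl⟩
        exact ⟨r, hr, _, ⟨V φ, hφ, rfl⟩, (U.map_smul r φ.1).symm⟩
      · rintro ⟨r, hr, _, ⟨φ, hφ, rfl⟩, h⟩
        have hφ' : U.symm φ.1 ∈ Metric.sphere (0 : EuclideanSpace ℂ (Bits Q)) 1 := by
          rw [mem_sphere_zero_iff_norm, U.symm.norm_map, norm_eq_of_mem_sphere]
        refine ⟨r, hr, _, ⟨⟨U.symm φ.1, hφ'⟩, ?_, rfl⟩, ?_⟩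
        · have : V ⟨U.symm φ.1, hφ'⟩ = φ := Subtype.ext (U.apply_symm_apply φ.1)
          rwa [this]
        · apply U.injective
          rw [U.map_smul, U.apply_symm_apply, h]
    rw [hset]
    exact U.measurePreserving.measure_preimage_equiv (f := U.toMeasurableEquiv) _
  conv_rhs => rw [← hmap]
  rw [integral_map hV.aemeasurable]
  exact (hf.comp continuous_subtype_val).aestronglyMeasurable

theorem moment_apply (k : ℕ) (S : Measure (PureState Q)) (x y : Fin k → Bits Q) :
    moment k S x y = ∫ φ, ∏ j, φ.1 (x j) * star (φ.1 (y j)) ∂S := rfl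

theorem moment_diag (k : ℕ) (S : Measure (PureState Q)) (x : Fin k → Bits Q) :
    moment k S x x = ((∫ φ, ∏ j, ‖φ.1 (x j)‖ ^ 2 ∂S : ℝ) : ℂ) := by
  rw [moment_apply, ← integral_complex_ofReal]
  congr 1 with φ
  push_cast
  exact Finset.prod_congr rfl fun j _ => Complex.mul_conj' _

theorem sum_norm_sq (φ : PureState Q) : ∑ z, ‖φ.1 z‖ ^ 2 = 1 := by
  rw [← EuclideanSpace.norm_sq_eq, norm_eq_of_mem_sphere]; norm_num

/-- Multiplication of the coordinate `a` by the phase `c`. -/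
def phaseIsometry (a : Bits Q) (c : Circle) :
    EuclideanSpace ℂ (Bits Q) ≃ₗᵢ[ℝ] EuclideanSpace ℂ (Bits Q) :=
  LinearIsometryEquiv.piLpCongrRight 2 fun z => if z = a then rotation c else .refl ℝ ℂ

theorem phaseIsometry_apply (a : Bits Q) (c : Circle) (φ : EuclideanSpace ℂ (Bits Q))
    (z : Bits Q) : phaseIsometry a c φ z = (if z = a then (c : ℂ) else 1) * φ z := by
  simp only [phaseIsometry, LinearIsometryEquiv.piLpCongrRight_apply]
  split_ifs <;> simp

/-- Rotating the phase of coordinate `a` multiplies the entry by a power of the phase whose exponent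
is the difference of the multiplicities of `a` in `x` and `y`. A nonzero entry forces equal
multiplicities for every `a`. -/
theorem exists_perm_of_moment_haar_ne_zero {k : ℕ} {x y : Fin k → Bits Q}
    (h : moment k (haarEnsemble Q) x y ≠ 0) : ∃ σ : Equiv.Perm (Fin k), y = x ∘ σ := by
  have hcard (a : Bits Q) : (Finset.univ.filter fun j => x j = a).card =
      (Finset.univ.filter fun j => y j = a).card := by
    -- The multiplicities lie between `0` and `k`, so a primitive root of order `k + 1` separates
    -- them.
    have hprim := Complex.isPrimitiveRoot_exp (k + 1) (by omega)
    set ω : ℂ := Complex.exp (2 * Real.pi * Complex.I / ((k + 1 : ℕ) : ℂ))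
    have hω : ‖ω‖ = 1 := hprim.norm'_eq_one (by omega)
    obtain ⟨c, hc⟩ : ∃ c : Circle, (c : ℂ) = ω := ⟨⟨ω, mem_sphere_zero_iff_norm.2 hω⟩, rfl⟩
    have hinv := haarEnsemble_integral_comp (phaseIsometry a c)
      (f := fun φ => ∏ j, φ (x j) * star (φ (y j))) (by fun_prop)
    have hf (φ : PureState Q) : ∏ j, phaseIsometry a c φ.1 (x j) *
          star (phaseIsometry a c φ.1 (y j)) =
        (ω ^ (Finset.univ.filter fun j => x j = a).card *
          star ω ^ (Finset.univ.filter fun j => y j = a).card) *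
          ∏ j, φ.1 (x j) * star (φ.1 (y j)) := by
      simp only [phaseIsometry_apply, star_mul', Finset.prod_mul_distrib, apply_ite star, star_one,
        Finset.prod_ite, Finset.prod_const, hc]
      ring
    simp only [hf, integral_const_mul] at hinv
    rw [← moment_apply] at hinv
    have h1 := mul_right_cancel₀ h (hinv.trans (one_mul _).symm)
    have hω' : star ω * ω = 1 := by
      rw [mul_comm]; exact (Complex.mul_conj' _).trans (by simp [hω])
    refine hprim.pow_inj ?_ ?_ ?_
    · exact Nat.lt_succ_of_le ((Finset.card_le_univ _).trans (by simp))
    · exact Nat.lt_succ_of_le ((Finset.card_le_univ _).trans (by simp))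
    · have := congrArg (· * ω ^ (Finset.univ.filter fun j => y j = a).card) h1
      rwa [mul_assoc, ← mul_pow, hω', one_pow, mul_one, one_mul] at this
  let e : Equiv.Perm (Fin k) := Equiv.ofFiberEquiv (f := y) (g := x) fun a =>
    Fintype.equivOfCardEq (by rw [Fintype.card_subtype, Fintype.card_subtype, hcard])
  exact ⟨e, funext fun j => (Equiv.ofFiberEquiv_map _ j).symm⟩

theorem moment_comp_perm (k : ℕ) (S : Measure (PureState Q)) (x y : Fin k → Bits Q)
    (σ : Equiv.Perm (Fin k)) : moment k S x (y ∘ σ) = moment k S x y := by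
  rw [moment_apply, moment_apply]
  congr 1 with φ
  rw [Finset.prod_mul_distrib, Finset.prod_mul_distrib]
  congr 1
  exact Equiv.prod_comp σ fun j => star (φ.1 (y j))

theorem piLpCongrLeft_symm_apply (e : Equiv.Perm (Bits Q)) (φ : EuclideanSpace ℂ (Bits Q))
    (z : Bits Q) : LinearIsometryEquiv.piLpCongrLeft 2 ℝ ℂ e.symm φ z = φ (e z) := by
  simp [LinearIsometryEquiv.piLpCongrLeft_apply]

/-- Permutations of the basis act transitively on injective tuples. The common value `p` is never
computed; the trace normalisation takes its place later. -/
theorem exists_moment_haar_eq (Q : Type) [Fintype Q] [DecidableEq Q] (k : ℕ) :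
    ∃ p : ℝ, ∀ x : Fin k → Bits Q, Function.Injective x →
      moment k (haarEnsemble Q) x x = p := by
  by_cases hx : ∃ x₀ : Fin k → Bits Q, Function.Injective x₀
  · obtain ⟨x₀, hx₀⟩ := hx
    refine ⟨∫ φ, ∏ j, ‖φ.1 (x₀ j)‖ ^ 2 ∂haarEnsemble Q, fun x hx => ?_⟩
    obtain ⟨e, he⟩ := Equiv.Perm.exists_extending_pair x₀ x hx₀ hx
    rw [moment_diag, ← haarEnsemble_integral_comp
      (LinearIsometryEquiv.piLpCongrLeft 2 ℝ ℂ e.symm)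
      (f := fun φ => ∏ j, ‖φ (x₀ j)‖ ^ 2) (by fun_prop)]
    simp only [piLpCongrLeft_symm_apply, he]
  · exact ⟨0, fun x h => absurd ⟨x, h⟩ hx⟩

/-- The fourth moments `𝔼 |φ_a|² |φ_b|²` of a Haar random state. -/
def haarFourthMoment (a b : Bits Q) : ℝ := ∫ φ, ‖φ.1 a‖ ^ 2 * ‖φ.1 b‖ ^ 2 ∂haarEnsemble Q

theorem haarFourthMoment_perm (e : Equiv.Perm (Bits Q)) (a b : Bits Q) :
    haarFourthMoment (e a) (e b) = haarFourthMoment a b := by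
  rw [haarFourthMoment, haarFourthMoment, ← haarEnsemble_integral_comp
    (LinearIsometryEquiv.piLpCongrLeft 2 ℝ ℂ e.symm)
    (f := fun φ => ‖φ a‖ ^ 2 * ‖φ b‖ ^ 2) (by fun_prop)]
  simp only [piLpCongrLeft_symm_apply]

theorem haarFourthMoment_self_eq (a b : Bits Q) :
    haarFourthMoment a a = haarFourthMoment b b := by
  rw [← haarFourthMoment_perm (Equiv.swap a b) a a, Equiv.swap_apply_left]

/-- The reflection in the complex line spanned by `2 e_a + e_b`. -/
def lineReflection (a b : Bits Q) :
    EuclideanSpace ℂ (Bits Q) ≃ₗᵢ[ℝ] EuclideanSpace ℂ (Bits Q) :=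
  let U := (ℂ ∙ (EuclideanSpace.single a (2 : ℂ) + EuclideanSpace.single b (1 : ℂ))).reflection
  ⟨U.toLinearEquiv.restrictScalars ℝ, U.norm_map⟩

theorem lineReflection_apply {a b : Bits Q} (hab : a ≠ b) (φ : EuclideanSpace ℂ (Bits Q)) :
    lineReflection a b φ a = (3 * φ a + 4 * φ b) / 5 := by
  have hn : ‖EuclideanSpace.single a (2 : ℂ) + EuclideanSpace.single b (1 : ℂ)‖ ^ 2 = 5 := by
    rw [@norm_add_sq ℂ]
    simp [EuclideanSpace.inner_single_left, hab]
    norm_num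
  have hU : lineReflection a b φ = (ℂ ∙ (EuclideanSpace.single a (2 : ℂ) +
    EuclideanSpace.single b (1 : ℂ))).reflection φ := rfl
  rw [hU, Submodule.reflection_singleton_apply, ← RCLike.ofReal_pow, hn]
  simp [inner_add_left, EuclideanSpace.inner_single_left, hab, Complex.conj_ofNat]
  ring

/-- Invariance under `lineReflection`, which mixes the coordinates with weights `3/5` and `4/5`,
gives a linear relation between the fourth moments. The terms odd in `φ b` vanish by the phase `-1`,
and the phase `I` gives the real and imaginary parts of `φ a * star (φ b)` equal second moments. -/
theorem haarFourthMoment_of_ne {a b : Bits Q} (hab : a ≠ b) :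
    haarFourthMoment a b = haarFourthMoment a a / 2 := by
  have hint {f : PureState Q → ℝ} (hf : Continuous f) : Integrable f (haarEnsemble Q) :=
    integrable_of_continuous _ hf
  have hU := haarEnsemble_integral_comp (lineReflection a b)
    (f := fun φ => ‖φ a‖ ^ 2 * ‖φ a‖ ^ 2) (by fun_prop)
  have hodd := haarEnsemble_integral_comp (phaseIsometry b (-1))
    (f := fun φ => (9 * ‖φ a‖ ^ 2 + 16 * ‖φ b‖ ^ 2) * (φ a * star (φ b)).re) (by fun_prop)
  obtain ⟨c, hc⟩ : ∃ c : Circle, (c : ℂ) = Complex.I :=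
    ⟨⟨Complex.I, mem_sphere_zero_iff_norm.2 Complex.norm_I⟩, rfl⟩
  have hrot := haarEnsemble_integral_comp (phaseIsometry a c)
    (f := fun φ => (φ a * star (φ b)).re ^ 2) (by fun_prop)
  have hsq : ∫ φ : PureState Q, (φ.1 a * star (φ.1 b)).re ^ 2 ∂haarEnsemble Q +
      ∫ φ : PureState Q, (φ.1 a * star (φ.1 b)).im ^ 2 ∂haarEnsemble Q =
        haarFourthMoment a b := by
    rw [haarFourthMoment, ← integral_add (hint (by fun_prop)) (hint (by fun_prop))]
    congr 1 with φ
    rw [← mul_pow, ← norm_star (φ.1 b), ← norm_mul, ← Complex.normSq_eq_norm_sq,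
      Complex.normSq_apply]
    ring
  have hexp (φ : PureState Q) : ‖lineReflection a b φ.1 a‖ ^ 2 * ‖lineReflection a b φ.1 a‖ ^ 2 =
      81 / 625 * (‖φ.1 a‖ ^ 2 * ‖φ.1 a‖ ^ 2) + 256 / 625 * (‖φ.1 b‖ ^ 2 * ‖φ.1 b‖ ^ 2) +
      288 / 625 * (‖φ.1 a‖ ^ 2 * ‖φ.1 b‖ ^ 2) +
      48 / 625 * ((9 * ‖φ.1 a‖ ^ 2 + 16 * ‖φ.1 b‖ ^ 2) * (φ.1 a * star (φ.1 b)).re) +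
      576 / 625 * (φ.1 a * star (φ.1 b)).re ^ 2 := by
    rw [lineReflection_apply hab]
    simp only [← Complex.normSq_eq_norm_sq, Complex.normSq_apply]
    simp
    ring
  have hneg : ∫ φ : PureState Q, (9 * ‖φ.1 a‖ ^ 2 + 16 * ‖φ.1 b‖ ^ 2) *
      (φ.1 a * star (φ.1 b)).re ∂haarEnsemble Q = 0 := by
    simp only [phaseIsometry_apply, hab, if_true, if_false, one_mul, Circle.coe_neg,
      Circle.coe_one, neg_mul, norm_neg, star_neg, mul_neg, Complex.neg_re, integral_neg] at hodd
    linarith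
  have hreim : ∫ φ : PureState Q, (φ.1 a * star (φ.1 b)).im ^ 2 ∂haarEnsemble Q =
      ∫ φ : PureState Q, (φ.1 a * star (φ.1 b)).re ^ 2 ∂haarEnsemble Q := by
    simpa only [phaseIsometry_apply, hc, hab.symm, if_true, if_false, one_mul, mul_assoc,
      Complex.I_mul_re, neg_sq] using hrot
  simp only [hexp] at hU
  rw [integral_add, integral_add, integral_add, integral_add] at hU
  · simp only [integral_const_mul, hneg] at hU
    have hb := haarFourthMoment_self_eq b a
    simp only [haarFourthMoment] at hb hsq ⊢
    rw [hb] at hU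
    linarith
  all_goals exact hint (by fun_prop)

theorem sum_haarFourthMoment : ∑ a : Bits Q, ∑ b : Bits Q, haarFourthMoment a b = 1 := by
  have hint (a b : Bits Q) : Integrable (fun φ : PureState Q => ‖φ.1 a‖ ^ 2 * ‖φ.1 b‖ ^ 2)
      (haarEnsemble Q) := integrable_of_continuous _ (by fun_prop)
  simp only [haarFourthMoment]
  simp_rw [← integral_finsetSum _ fun b _ => hint _ b]
  rw [← integral_finsetSum _ fun a _ => integrable_finsetSum _ fun b _ => hint a b]
  simp_rw [← Finset.mul_sum, sum_norm_sq, mul_one, sum_norm_sq]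
  simp

/-- All values are `m * (1 + δ_ab)` for one `m`, and the total `m * (d ^ 2 + d) = 1`, with `d = 2 ^
|Q|`, fixes `m`. -/
theorem haarFourthMoment_eq (a b : Bits Q) : haarFourthMoment a b =
    (1 + if a = b then 1 else 0) / (2 ^ Fintype.card Q * (2 ^ Fintype.card Q + 1)) := by
  obtain ⟨m, hm⟩ : ∃ m : ℝ, ∀ b c : Bits Q, haarFourthMoment b c =
      m * (1 + if b = c then 1 else 0) := by
    refine ⟨haarFourthMoment a a / 2, fun b c => ?_⟩
    split_ifs with h
    · rw [h, haarFourthMoment_self_eq c a]; ring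
    · rw [haarFourthMoment_of_ne h, haarFourthMoment_self_eq b a]; ring
  have hs := sum_haarFourthMoment (Q := Q)
  simp only [hm, ← Finset.mul_sum, Finset.sum_add_distrib, Finset.sum_const, Finset.sum_ite_eq,
    Finset.mem_univ, if_true, Finset.card_univ, nsmul_eq_mul, mul_one] at hs
  rw [hm a b]
  have hd : (Fintype.card (Bits Q) : ℝ) = 2 ^ Fintype.card Q := by simp
  rw [hd] at hs
  rw [eq_div_iff (by positivity)]
  linear_combination (1 + if a = b then (1 : ℝ) else 0) * hs

end Haar

/-! ### Positivity of averaged rank-one matrices, and collision weights of moments. -/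

theorem posSemidef_integral {ι : Type*} [Fintype ι] {X : Type*} [MeasurableSpace X]
    (μ : Measure X) (g : X → ι → ℂ)
    (hg : ∀ x y, Integrable (fun ω => g ω x * star (g ω y)) μ) :
    (Matrix.of fun x y => ∫ ω, g ω x * star (g ω y) ∂μ).PosSemidef := by
  refine Matrix.PosSemidef.of_dotProduct_mulVec_nonneg ?_ fun v => ?_
  · ext x y
    rw [Matrix.conjTranspose_apply, Matrix.of_apply, Matrix.of_apply]
    refine integral_conj.symm.trans (integral_congr_ae (.of_forall fun ω => ?_))
    simp [mul_comm]
  · have h : star v ⬝ᵥ (Matrix.of fun x y => ∫ ω, g ω x * star (g ω y) ∂μ) *ᵥ v =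
        ((∫ ω, ‖∑ x, star (v x) * g ω x‖ ^ 2 ∂μ : ℝ) : ℂ) := by
      simp only [dotProduct, Matrix.mulVec, Matrix.of_apply, Pi.star_apply, Finset.mul_sum,
        ← integral_mul_const, ← integral_const_mul]
      simp_rw [← integral_finsetSum _ fun y _ => ((hg _ y).mul_const _).const_mul _]
      rw [← integral_finsetSum _ fun x _ => integrable_finsetSum _ fun y _ =>
        ((hg x y).mul_const _).const_mul _, ← integral_complex_ofReal]
      congr 1 with ω
      push_cast
      rw [← Complex.mul_conj', map_sum, Finset.sum_mul_sum]
      refine Finset.sum_congr rfl fun x _ => Finset.sum_congr rfl fun y _ => ?_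
      simp
      ring
    rw [h]
    exact_mod_cast integral_nonneg fun ω => by positivity

section Moments

variable {Q : Type} [Fintype Q] [DecidableEq Q]

theorem moment_posSemidef (k : ℕ) (S : Measure (PureState Q)) [IsFiniteMeasure S] :
    (moment k S).PosSemidef := by
  have h := posSemidef_integral S (fun φ (x : Fin k → Bits Q) => ∏ j, φ.1 (x j))
    fun x y => integrable_of_continuous S (by fun_prop)
  convert h using 1
  ext x y
  simp only [moment_apply, Matrix.of_apply, Finset.prod_mul_distrib, star_prod]

theorem moment_diag_re (k : ℕ) (S : Measure (PureState Q)) (x : Fin k → Bits Q) :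
    (moment k S x x).re = ∫ φ, ∏ j, ‖φ.1 (x j)‖ ^ 2 ∂S := by
  rw [moment_diag, Complex.ofReal_re]

theorem moment_diag_re_nonneg (k : ℕ) (S : Measure (PureState Q)) (x : Fin k → Bits Q) :
    0 ≤ (moment k S x x).re := by
  rw [moment_diag_re]
  exact integral_nonneg fun φ => by positivity

theorem sum_moment_diag_re (k : ℕ) (S : Measure (PureState Q)) [IsProbabilityMeasure S] :
    ∑ x, (moment k S x x).re = 1 := by
  simp_rw [moment_diag_re]
  rw [← integral_finsetSum _ fun x _ => integrable_of_continuous S (by fun_prop)]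
  have h (φ : PureState Q) : ∑ x : Fin k → Bits Q, ∏ j, ‖φ.1 (x j)‖ ^ 2 = 1 := by
    rw [← Fintype.prod_sum fun (_ : Fin k) z => ‖φ.1 z‖ ^ 2, sum_norm_sq, Finset.prod_const_one]
  simp [h]

/-- Only copies `i` and `j` enter the collision condition; each other copy sums to one. Hence
`k`-copy collisions need only fourth moments. -/
theorem sum_collision_prod {k : ℕ} {α β : Type*} [Fintype α] [DecidableEq α] [Fintype β]
    [DecidableEq β] (r : α → β) (q : α → ℝ) (hq : ∑ u, q u = 1) {i j : Fin k} (hij : i ≠ j) :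
    ∑ x : Fin k → α, (if r (x i) = r (x j) then ∏ l, q (x l) else 0) =
      ∑ u, ∑ v, if r u = r v then q u * q v else 0 := by
  -- Splitting by the common value `s` turns the collision indicator into a product over copies.
  have hsplit (u v : α) (c : ℝ) : (if r u = r v then c else 0) =
      ∑ s, (if r u = s then 1 else 0) * (if r v = s then 1 else 0) * c := by
    simp [ite_mul, eq_comm]
  simp_rw [hsplit]
  rw [Finset.sum_comm]
  conv_rhs => enter [2, u]; rw [Finset.sum_comm]
  conv_rhs => rw [Finset.sum_comm]
  refine Finset.sum_congr rfl fun s _ => ?_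
  let p : α → ℝ := fun u => if r u = s then 1 else 0
  calc ∑ x : Fin k → α, p (x i) * p (x j) * ∏ l, q (x l)
      = ∑ x : Fin k → α, ∏ l, (if l = i then p (x l) else 1) * (if l = j then p (x l) else 1) *
          q (x l) := by
        simp only [Finset.prod_mul_distrib, Finset.prod_ite_eq', Finset.mem_univ, if_true]
    _ = ∏ l : Fin k, ∑ u, (if l = i then p u else 1) * (if l = j then p u else 1) * q u :=
        (Fintype.prod_sum fun (l : Fin k) u =>
          (if l = i then p u else 1) * (if l = j then p u else 1) * q u).symm
    _ = ∏ l : Fin k, (if l = i then ∑ u, p u * q u else 1) *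
          (if l = j then ∑ u, p u * q u else 1) := by
        refine Finset.prod_congr rfl fun l _ => ?_
        by_cases h1 : l = i
        · simp [h1, hij]
        · by_cases h2 : l = j
          · simp [h2, hij.symm]
          · simp [h1, h2, hq]
    _ = (∑ u, p u * q u) * ∑ v, p v * q v := by
        simp only [Finset.prod_mul_distrib, Finset.prod_ite_eq', Finset.mem_univ, if_true]
    _ = ∑ u, ∑ v, p u * p v * (q u * q v) := by
        rw [Finset.sum_mul_sum]
        exact Finset.sum_congr rfl fun u _ => Finset.sum_congr rfl fun v _ => by ring

theorem card_bits_comp_eq {R : Type} [Fintype R] {g : R → Q} (hg : Function.Injective g)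
    (w : Bits Q) : (Finset.univ.filter fun u : Bits Q => w ∘ g = u ∘ g).card * 2 ^ Fintype.card R =
      2 ^ Fintype.card Q := by
  classical
  have h1 : (Finset.univ.filter fun u : Bits Q => w ∘ g = u ∘ g) =
      Fintype.piFinset fun q => if q ∈ Finset.univ.image g then {w q} else Finset.univ := by
    ext u
    simp only [Finset.mem_filter, Finset.mem_univ, true_and, Fintype.mem_piFinset, funext_iff,
      Function.comp_apply]
    constructor
    · intro h q
      split_ifs with hq
      · obtain ⟨a, -, rfl⟩ := Finset.mem_image.1 hq
        simp [h a]
      · simp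
    · intro h a
      have := h (g a)
      rw [if_pos (Finset.mem_image_of_mem g (Finset.mem_univ a)), Finset.mem_singleton] at this
      exact this.symm
  have h2 : 2 ^ Fintype.card R = ∏ q, if q ∈ Finset.univ.image g then 2 else 1 := by
    rw [Finset.prod_ite_mem, Finset.univ_inter, Finset.prod_const,
      Finset.card_image_of_injective _ hg, Finset.card_univ]
  rw [h1, Fintype.card_piFinset, h2, ← Finset.prod_mul_distrib, ← Finset.card_univ,
    ← Finset.prod_const]
  refine Finset.prod_congr rfl fun q _ => ?_
  split_ifs <;> simp

theorem sum_collision_moment_haar_le {R : Type} [Fintype R] {g : R → Q}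
    (hg : Function.Injective g) {k : ℕ} {i j : Fin k} (hij : i ≠ j) :
    ∑ x : Fin k → Bits Q, (if x i ∘ g = x j ∘ g then (moment k (haarEnsemble Q) x x).re else 0) ≤
      2 / 2 ^ Fintype.card R := by
  classical
  have hint {f : PureState Q → ℝ} (hf : Continuous f) : Integrable f (haarEnsemble Q) :=
    integrable_of_continuous _ hf
  have hstep : ∑ x : Fin k → Bits Q,
      (if x i ∘ g = x j ∘ g then (moment k (haarEnsemble Q) x x).re else 0) =
      ∑ u : Bits Q, ∑ v : Bits Q, if u ∘ g = v ∘ g then haarFourthMoment u v else 0 := by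
    have h1 (c : Prop) [Decidable c] (f : PureState Q → ℝ) :
        (if c then ∫ φ, f φ ∂haarEnsemble Q else 0) =
          ∫ φ, (if c then f φ else 0) ∂haarEnsemble Q := by
      split_ifs <;> simp
    have h2 (c : Prop) [Decidable c] {f : PureState Q → ℝ} (hf : Continuous f) :
        Integrable (fun φ => if c then f φ else 0) (haarEnsemble Q) := by
      split_ifs
      · exact hint hf
      · simp
    simp_rw [moment_diag_re, haarFourthMoment, h1]
    rw [← integral_finsetSum _ fun x _ => h2 _ (by fun_prop)]
    have h3 (u v : Bits Q) := h2 (u ∘ g = v ∘ g)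
      (by fun_prop : Continuous fun φ : PureState Q => ‖φ.1 u‖ ^ 2 * ‖φ.1 v‖ ^ 2)
    simp_rw [← integral_finsetSum _ fun v _ => h3 _ v]
    rw [← integral_finsetSum _ fun u _ => integrable_finsetSum _ fun v _ => h3 u v]
    congr 1 with φ
    exact sum_collision_prod (fun u : Bits Q => u ∘ g) _ (sum_norm_sq φ) hij
  rw [hstep]
  set D : ℝ := 2 ^ Fintype.card Q with hD
  set X : ℝ := 2 ^ Fintype.card R with hX
  -- The total collision weight is `(D / X + 1) / (D + 1)`; `X ≤ D` bounds it by `2 / X`.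
  have hDX : X ≤ D := pow_le_pow_right₀ one_le_two (Fintype.card_le_of_injective g hg)
  have hX0 : 0 < X := by positivity
  have hD0 : 0 < D := by positivity
  have hrow (u : Bits Q) : ∑ v : Bits Q, (if u ∘ g = v ∘ g then haarFourthMoment u v else 0) =
      (D / X + 1) / (D * (D + 1)) := by
    have hc : ((Finset.univ.filter fun v : Bits Q => u ∘ g = v ∘ g).card : ℝ) = D / X := by
      rw [eq_div_iff hX0.ne', hX, hD]
      exact_mod_cast card_bits_comp_eq hg u
    simp_rw [haarFourthMoment_eq]
    rw [← Finset.sum_filter, ← Finset.sum_div, Finset.sum_add_distrib, Finset.sum_const,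
      nsmul_eq_mul, mul_one, hc, Finset.sum_ite_eq, if_pos (by simp)]
  simp_rw [hrow]
  rw [Finset.sum_const, Finset.card_univ, nsmul_eq_mul]
  have hd : (Fintype.card (Bits Q) : ℝ) = D := by simp [hD]
  rw [hd, ← mul_div_assoc, mul_div_mul_left _ _ hD0.ne', div_le_div_iff₀ (by positivity) hX0, add_mul,
    div_mul_cancel₀ _ hX0.ne']
  linarith

end Moments

/-! ### Comparing two unit-trace matrices that are proportional on a block. -/

section BlockComparison

variable {ι : Type} [Fintype ι]

theorem IsTraceBounded.real_smul {T : Matrix ι ι ℂ} (hT : T.PosSemidef) (c : ℝ) :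
    IsTraceBounded ((c : ℂ) • T) (|c| * T.trace.re) := by
  rcases le_total 0 c with hc | hc
  · have h : (0 : ℂ) ≤ (c : ℂ) := by exact_mod_cast hc
    have := IsTraceBounded.of_posSemidef (hT.smul h)
    rwa [Matrix.trace_smul, smul_eq_mul, Complex.re_ofReal_mul,
      ← congrArg (· * T.trace.re) (abs_of_nonneg hc)] at this
  · have h : (0 : ℂ) ≤ ((-c : ℝ) : ℂ) := by exact_mod_cast neg_nonneg.2 hc
    refine ⟨0, ((-c : ℝ) : ℂ) • T, .zero, hT.smul h, by simp, ?_⟩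
    rw [Matrix.trace_smul, smul_eq_mul, Complex.re_ofReal_mul, abs_of_nonpos hc]
    simp

/-- `M` is block diagonal for the splitting by `D`, and `T` lives on the block `D`. The remainder
`R` is the compression of `M` to the complement of `D`, hence positive. -/
theorem eq_smul_add_block (D : ι → Prop) [DecidablePred D] {M T : Matrix ι ι ℂ} {c : ℂ}
    (hM : M.PosSemidef) (hT : T.PosSemidef) (hT0 : ∀ x y, ¬ D y → T x y = 0)
    (hMD : ∀ x y, D x → D y → M x y = c * T x y) (hM0 : ∀ x y, D x → ¬ D y → M x y = 0) :
    ∃ R : Matrix ι ι ℂ, R.PosSemidef ∧ M = c • T + R ∧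
      R.trace.re = ∑ x, if D x then 0 else (M x x).re := by
  classical
  let E : Matrix ι ι ℂ := Matrix.diagonal fun x => if D x then 0 else 1
  have hE (x y : ι) : (Eᴴ * M * E) x y = if D x ∨ D y then 0 else M x y := by
    simp only [E, Matrix.diagonal_conjTranspose, Matrix.mul_diagonal, Matrix.diagonal_mul]
    by_cases hx : D x <;> by_cases hy : D y <;> simp [hx, hy]
  refine ⟨Eᴴ * M * E, hM.conjTranspose_mul_mul_same E, ?_, ?_⟩
  · ext x y
    rw [Matrix.add_apply, Matrix.smul_apply, smul_eq_mul, hE]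
    by_cases hx : D x <;> by_cases hy : D y
    · simp [hx, hMD x y hx hy]
    · simp [hx, hM0 x y hx hy, hT0 x y hy]
    · have h1 : M x y = 0 := by rw [← hM.1.apply, hM0 y x hy hx, star_zero]
      have h2 : T x y = 0 := by rw [← hT.1.apply, hT0 y x hx, star_zero]
      simp [hy, h1, h2]
    · simp [hx, hy, hT0 x y hy]
  · rw [Matrix.trace, Complex.re_sum]
    refine Finset.sum_congr rfl fun x _ => ?_
    by_cases hx : D x <;> simp [hE, hx]

/-- Write `M = cT + R` and `N = dT + R'`. Equal traces give `|c - d| tr T ≤ tr R + tr R' ≤ 2δ`, and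
`R - R'` costs another `2δ`. The values of `c` and `d` play no role. -/
theorem IsTraceBounded.of_proportional_block (D : ι → Prop) [DecidablePred D]
    {M N T : Matrix ι ι ℂ} {c d : ℝ}
    (hM : M.PosSemidef) (hN : N.PosSemidef) (hT : T.PosSemidef)
    (hM1 : M.trace.re = 1) (hN1 : N.trace.re = 1) (hT0 : ∀ x y, ¬ D y → T x y = 0)
    (hMD : ∀ x y, D x → D y → M x y = c * T x y) (hM0 : ∀ x y, D x → ¬ D y → M x y = 0)
    (hND : ∀ x y, D x → D y → N x y = d * T x y) (hN0 : ∀ x y, D x → ¬ D y → N x y = 0)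
    {δ : ℝ} (hMδ : ∑ x, (if D x then 0 else (M x x).re) ≤ δ)
    (hNδ : ∑ x, (if D x then 0 else (N x x).re) ≤ δ) :
    IsTraceBounded (M - N) (4 * δ) := by
  obtain ⟨R, hR, hMR, hRtr⟩ := eq_smul_add_block D hM hT hT0 hMD hM0
  obtain ⟨R', hR', hNR, hRtr'⟩ := eq_smul_add_block D hN hT hT0 hND hN0
  have hb := (IsTraceBounded.real_smul hT (c - d)).add (.sub_of_posSemidef hR hR')
  have hsub : M - N = ((c - d : ℝ) : ℂ) • T + (R - R') := by
    rw [hMR, hNR, Complex.ofReal_sub, sub_smul]; abel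
  rw [hsub]
  refine hb.mono ?_
  rw [hMR, Matrix.trace_add, Matrix.trace_smul, smul_eq_mul, Complex.add_re,
    Complex.re_ofReal_mul] at hM1
  rw [hNR, Matrix.trace_add, Matrix.trace_smul, smul_eq_mul, Complex.add_re,
    Complex.re_ofReal_mul] at hN1
  have hT1 : 0 ≤ T.trace.re := (Complex.le_def.1 hT.trace_nonneg).1
  have hR1 : 0 ≤ R.trace.re := (Complex.le_def.1 hR.trace_nonneg).1
  have hR1' : 0 ≤ R'.trace.re := (Complex.le_def.1 hR'.trace_nonneg).1
  rw [← abs_of_nonneg hT1, ← abs_mul, sub_mul]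
  have habs : |c * T.trace.re - d * T.trace.re| ≤ R.trace.re + R'.trace.re := by
    rw [abs_le]; constructor <;> linarith
  linarith

/-- Union bound over the `k ^ 2` ordered pairs of copies. -/
theorem sum_not_injective_le {k : ℕ} {β : Type*} {m : ι → ℝ} (hm : ∀ x, 0 ≤ m x)
    (α : ι → Fin k → β) {ε : ℝ} (hε : 0 ≤ ε) [DecidableEq β]
    [DecidablePred fun x => Function.Injective (α x)]
    (h : ∀ i j, i ≠ j → ∑ x, (if α x i = α x j then m x else 0) ≤ ε) :
    ∑ x, (if Function.Injective (α x) then 0 else m x) ≤ k ^ 2 * ε := by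
  have hpt (x : ι) : (if Function.Injective (α x) then 0 else m x) ≤
      ∑ i, ∑ j, if i ≠ j ∧ α x i = α x j then m x else 0 := by
    have hnn (i j : Fin k) : 0 ≤ if i ≠ j ∧ α x i = α x j then m x else 0 := by
      split_ifs <;> simp [hm]
    split_ifs with hx
    · exact Finset.sum_nonneg fun i _ => Finset.sum_nonneg fun j _ => hnn i j
    · simp only [Function.Injective, not_forall] at hx
      obtain ⟨i, j, hij, hne⟩ := hx
      refine le_trans ?_ (Finset.single_le_sum
        (fun i _ => Finset.sum_nonneg fun j _ => hnn i j) (Finset.mem_univ i))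
      refine le_trans ?_ (Finset.single_le_sum (fun j _ => hnn i j) (Finset.mem_univ j))
      rw [if_pos ⟨hne, hij⟩]
  calc _ ≤ ∑ x, ∑ i, ∑ j, if i ≠ j ∧ α x i = α x j then m x else 0 :=
        Finset.sum_le_sum fun x _ => hpt x
    _ = ∑ i, ∑ j, ∑ x, if i ≠ j ∧ α x i = α x j then m x else 0 := by
        rw [Finset.sum_comm]
        exact Finset.sum_congr rfl fun i _ => Finset.sum_comm
    _ ≤ ∑ _i : Fin k, ∑ _j : Fin k, ε := by
        refine Finset.sum_le_sum fun i _ => Finset.sum_le_sum fun j _ => ?_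
        by_cases hij : i = j
        · simpa [hij] using hε
        · simpa [hij] using h i j hij
    _ = k ^ 2 * ε := by simp; ring

end BlockComparison

theorem exists_perm_of_image_eq {k : ℕ} {α : Type*} [DecidableEq α] {x y : Fin k → α}
    (hx : Function.Injective x) (hy : Function.Injective y)
    (h : Finset.univ.image x = Finset.univ.image y) : ∃ σ : Equiv.Perm (Fin k), y = x ∘ σ := by
  have hr : Set.range y = Set.range x := by
    simpa using (congrArg (fun s : Finset α => (s : Set α)) h).symm
  refine ⟨(Equiv.ofInjective y hy).trans
    ((Equiv.setCongr hr).trans (Equiv.ofInjective x hx).symm), funext fun j => ?_⟩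
  simp [Equiv.apply_ofInjective_symm hx]

/-! ### Expected signs of a `2k`-wise independent function. -/

section Signs

variable {X : Type} [Fintype X] [DecidableEq X]

theorem IsWiseIndependent.integral_prod_sign {t : ℕ} {ν : Measure (X → Bool)}
    [IsProbabilityMeasure ν] (hν : IsWiseIndependent t ν) (ht : t ≤ Fintype.card X)
    {S : Finset X} (hS : S.Nonempty) (hSt : S.card ≤ t) :
    ∫ f, ∏ s ∈ S, (-1 : ℂ) ^ (f s).toNat ∂ν = 0 := by
  -- Independence speaks of exactly `t` points, so `S` is padded to `T`. The padding points
  -- contribute the factor `1`, and a point of `S` contributes a sum of signs equal to zero.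
  obtain ⟨T, hST, hT⟩ := Finset.exists_superset_card_eq hSt (by simpa using ht)
  let x : Fin t → X := fun i => (T.equivFinOfCardEq hT).symm i
  have hx : Function.Injective x :=
    Subtype.val_injective.comp (T.equivFinOfCardEq hT).symm.injective
  let h : (Fin t → Bool) → ℂ := fun y => ∏ i, if x i ∈ S then (-1 : ℂ) ^ (y i).toNat else 1
  have hprod (f : X → Bool) : ∏ s ∈ S, (-1 : ℂ) ^ (f s).toNat = h fun i => f (x i) := by
    have h1 : ∏ s ∈ S, (-1 : ℂ) ^ (f s).toNat =
        ∏ s ∈ T, if s ∈ S then (-1 : ℂ) ^ (f s).toNat else 1 := by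
      rw [Finset.prod_ite_mem, Finset.inter_eq_right.2 hST]
    rw [h1, ← Finset.prod_coe_sort]
    exact ((T.equivFinOfCardEq hT).symm.prod_comp
      fun s : T => if (s : X) ∈ S then (-1 : ℂ) ^ (f s).toNat else 1).symm
  have hm : Measurable fun (f : X → Bool) (i : Fin t) => f (x i) := by fun_prop
  have hlaw (y : Fin t → Bool) :
      (ν.map fun (f : X → Bool) (i : Fin t) => f (x i)).real {y} = ((2 : ℝ) ^ t)⁻¹ := by
    rw [← hν x hx y, map_measureReal_apply hm (measurableSet_singleton y)]
    congr 1
    ext f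
    simp [funext_iff]
  have hprob := Measure.isProbabilityMeasure_map hm.aemeasurable (μ := ν)
  simp_rw [hprod]
  rw [← integral_map (φ := fun (f : X → Bool) (i : Fin t) => f (x i)) (f := h) hm.aemeasurable
    (measurable_of_countable h).aestronglyMeasurable, integral_fintype (.of_finite)]
  simp_rw [hlaw]
  rw [← Finset.smul_sum]
  have hsum : ∑ y, h y = ∏ i, ∑ b : Bool, if x i ∈ S then (-1 : ℂ) ^ b.toNat else 1 :=
    (Fintype.prod_sum fun (i : Fin t) (b : Bool) =>
      if x i ∈ S then (-1 : ℂ) ^ b.toNat else 1).symm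
  obtain ⟨s, hs⟩ := hS
  have hi : x (T.equivFinOfCardEq hT ⟨s, hST hs⟩) = s := by simp [x]
  rw [hsum, Finset.prod_eq_zero (Finset.mem_univ (T.equivFinOfCardEq hT ⟨s, hST hs⟩)), smul_zero]
  simp [hi, hs]

theorem sign_mul_self (b : Bool) : (-1 : ℂ) ^ b.toNat * (-1 : ℂ) ^ b.toNat = 1 := by
  cases b <;> simp

theorem star_sign (b : Bool) : star ((-1 : ℂ) ^ b.toNat) = (-1 : ℂ) ^ b.toNat := by
  cases b <;> simp

/-- Signs at common points square to one, leaving a product over the symmetric difference of the two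
images. It has at most `2k` points, which is why `2k`-wise independence suffices. -/
theorem IsWiseIndependent.image_eq_of_integral_ne_zero {k : ℕ} {ν : Measure (X → Bool)}
    [IsProbabilityMeasure ν] (hν : IsWiseIndependent (2 * k) ν) (hk : 2 * k ≤ Fintype.card X)
    {u v : Fin k → X} (hu : Function.Injective u) (hv : Function.Injective v)
    (h : ∫ f, (∏ j, (-1 : ℂ) ^ (f (u j)).toNat) * star (∏ j, (-1 : ℂ) ^ (f (v j)).toNat) ∂ν ≠ 0) :
    Finset.univ.image u = Finset.univ.image v := by
  by_contra hne
  set S := Finset.univ.image u with hS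
  set S' := Finset.univ.image v with hS'
  refine h ?_
  have hprod (f : X → Bool) : (∏ j, (-1 : ℂ) ^ (f (u j)).toNat) *
      star (∏ j, (-1 : ℂ) ^ (f (v j)).toNat) = ∏ s ∈ symmDiff S S', (-1 : ℂ) ^ (f s).toNat := by
    have h1 : ∏ j, (-1 : ℂ) ^ (f (u j)).toNat = ∏ s ∈ S, (-1 : ℂ) ^ (f s).toNat :=
      (Finset.prod_image (f := fun s => (-1 : ℂ) ^ (f s).toNat) hu.injOn).symm
    have h2 : ∏ j, (-1 : ℂ) ^ (f (v j)).toNat = ∏ s ∈ S', (-1 : ℂ) ^ (f s).toNat :=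
      (Finset.prod_image (f := fun s => (-1 : ℂ) ^ (f s).toNat) hv.injOn).symm
    have hsq : (∏ s ∈ S ∩ S', (-1 : ℂ) ^ (f s).toNat) *
        ∏ s ∈ S ∩ S', (-1 : ℂ) ^ (f s).toNat = 1 := by
      rw [← Finset.prod_mul_distrib]
      exact Finset.prod_eq_one fun s _ => sign_mul_self _
    rw [star_prod]
    simp_rw [star_sign]
    rw [h1, h2, symmDiff_def, Finset.sup_eq_union,
      Finset.prod_union disjoint_sdiff_sdiff, ← Finset.prod_inter_mul_prod_sdiff S S',
      ← Finset.prod_inter_mul_prod_sdiff S' S, Finset.inter_comm S' S]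
    linear_combination (∏ s ∈ S \ S', (-1 : ℂ) ^ (f s).toNat) *
      (∏ s ∈ S' \ S, (-1 : ℂ) ^ (f s).toNat) * hsq
  simp_rw [hprod]
  refine hν.integral_prod_sign hk ?_ ?_
  · rw [Finset.nonempty_iff_ne_empty, ← Finset.bot_eq_empty, Ne, symmDiff_eq_bot]
    exact hne
  · have h1 : S.card ≤ k := Finset.card_image_le.trans (by simp)
    have h2 : S'.card ≤ k := Finset.card_image_le.trans (by simp)
    have h3 : (symmDiff S S').card ≤ (S ∪ S').card :=
      Finset.card_le_card symmDiff_le_sup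
    have h4 := Finset.card_union_le S S'
    omega

end Signs

/-! ### The glued moment and its comparison with the global Haar moment. -/

noncomputable section Glue

variable {A B : Type} [Fintype A] [DecidableEq A] [Fintype B] [DecidableEq B] {k : ℕ}

/-- The `A`-parts of a tuple of bitstrings on `A ⊔ B`. -/
def leftBits (x : Fin k → Bits (A ⊕ B)) : Fin k → Bits A := fun j => x j ∘ Sum.inl

/-- The `B`-parts of a tuple of bitstrings on `A ⊔ B`. -/
def rightBits (x : Fin k → Bits (A ⊕ B)) : Fin k → Bits B := fun j => x j ∘ Sum.inr

theorem sum_left_mul_right (F : (Fin k → Bits A) → ℝ) (G : (Fin k → Bits B) → ℝ) :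
    ∑ x : Fin k → Bits (A ⊕ B), F (leftBits x) * G (rightBits x) = (∑ a, F a) * ∑ b, G b := by
  let e : (Fin k → Bits (A ⊕ B)) ≃ (Fin k → Bits A) × (Fin k → Bits B) :=
    ((Equiv.refl (Fin k)).arrowCongr (Equiv.sumArrowEquivProdArrow A B Bool)).trans
      (Equiv.arrowProdEquivProdArrow (Fin k) (fun _ => Bits A) fun _ => Bits B)
  rw [Finset.sum_mul_sum, ← Fintype.sum_prod_type']
  exact e.sum_comp fun p => F p.1 * G p.2

/-- The matrix of the signs that the random phase operator multiplies the entries of a `k`-th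
moment by. -/
def phaseMatrix (k : ℕ) (ΞA : Finset A) (ΞB : Finset B) (ν : Measure (Bits (ΞA ⊕ ΞB) → Bool)) :
    Matrix (Fin k → Bits (A ⊕ B)) (Fin k → Bits (A ⊕ B)) ℂ :=
  Matrix.of fun x y => ∫ f, (∏ j, (-1 : ℂ) ^ (f (restrictBits ΞA ΞB (x j))).toNat) *
    star (∏ j, (-1 : ℂ) ^ (f (restrictBits ΞA ΞB (y j))).toNat) ∂ν

/-- The tensor product of a matrix on `k` copies of `A` and a matrix on `k` copies of `B`, after
the application of the random phase operator. -/
def glueMatrix (ΞA : Finset A) (ΞB : Finset B) (ν : Measure (Bits (ΞA ⊕ ΞB) → Bool))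
    (M : Matrix (Fin k → Bits A) (Fin k → Bits A) ℂ)
    (N : Matrix (Fin k → Bits B) (Fin k → Bits B) ℂ) :
    Matrix (Fin k → Bits (A ⊕ B)) (Fin k → Bits (A ⊕ B)) ℂ :=
  (M.submatrix leftBits leftBits ⊙ N.submatrix rightBits rightBits) ⊙ phaseMatrix k ΞA ΞB ν

variable (ΞA : Finset A) (ΞB : Finset B) (ν : Measure (Bits (ΞA ⊕ ΞB) → Bool))
  (M M' : Matrix (Fin k → Bits A) (Fin k → Bits A) ℂ)
  (N N' : Matrix (Fin k → Bits B) (Fin k → Bits B) ℂ)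

theorem glueMatrix_apply (x y : Fin k → Bits (A ⊕ B)) : glueMatrix ΞA ΞB ν M N x y =
    M (leftBits x) (leftBits y) * N (rightBits x) (rightBits y) * phaseMatrix k ΞA ΞB ν x y := rfl

theorem glueMatrix_sub_left :
    glueMatrix ΞA ΞB ν (M - M') N = glueMatrix ΞA ΞB ν M N - glueMatrix ΞA ΞB ν M' N := by
  ext x y
  simp only [glueMatrix_apply, Matrix.sub_apply]
  ring

theorem glueMatrix_sub_right :
    glueMatrix ΞA ΞB ν M (N - N') = glueMatrix ΞA ΞB ν M N - glueMatrix ΞA ΞB ν M N' := by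
  ext x y
  simp only [glueMatrix_apply, Matrix.sub_apply]
  ring

theorem phaseMatrix_posSemidef [IsFiniteMeasure ν] : (phaseMatrix k ΞA ΞB ν).PosSemidef :=
  posSemidef_integral ν
    (fun f (x : Fin k → Bits (A ⊕ B)) => ∏ j, (-1 : ℂ) ^ (f (restrictBits ΞA ΞB (x j))).toNat)
    fun _ _ => .of_finite

theorem phaseMatrix_comp_perm [IsProbabilityMeasure ν] (x : Fin k → Bits (A ⊕ B))
    (σ : Equiv.Perm (Fin k)) : phaseMatrix k ΞA ΞB ν x (x ∘ σ) = 1 := by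
  have h (f : Bits (ΞA ⊕ ΞB) → Bool) :
      (∏ j, (-1 : ℂ) ^ (f (restrictBits ΞA ΞB (x j))).toNat) *
        star (∏ j, (-1 : ℂ) ^ (f (restrictBits ΞA ΞB ((x ∘ σ) j))).toNat) = 1 := by
    rw [star_prod]
    simp_rw [star_sign, Function.comp_apply]
    rw [Equiv.prod_comp σ fun j => (-1 : ℂ) ^ (f (restrictBits ΞA ΞB (x j))).toNat,
      ← Finset.prod_mul_distrib]
    exact Finset.prod_eq_one fun j _ => sign_mul_self _
  rw [phaseMatrix, Matrix.of_apply]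
  simp_rw [h]
  simp

theorem glueMatrix_posSemidef [IsFiniteMeasure ν] {M : Matrix (Fin k → Bits A) (Fin k → Bits A) ℂ}
    {N : Matrix (Fin k → Bits B) (Fin k → Bits B) ℂ} (hM : M.PosSemidef) (hN : N.PosSemidef) :
    (glueMatrix ΞA ΞB ν M N).PosSemidef :=
  ((hM.submatrix _).hadamard (hN.submatrix _)).hadamard (phaseMatrix_posSemidef ΞA ΞB ν)

/-- Equal indices give equal signs, so `phaseMatrix` has unit diagonal and the phases do not affect
diagonal weights or traces. -/
theorem glueMatrix_diag_re [IsProbabilityMeasure ν]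
    {M : Matrix (Fin k → Bits A) (Fin k → Bits A) ℂ} (hM : M.PosSemidef)
    (x : Fin k → Bits (A ⊕ B)) : (glueMatrix ΞA ΞB ν M N x x).re =
      (M (leftBits x) (leftBits x)).re * (N (rightBits x) (rightBits x)).re := by
  have hp : phaseMatrix k ΞA ΞB ν x x = 1 := phaseMatrix_comp_perm ΞA ΞB ν x 1
  have him := (Complex.le_def.1 (hM.diag_nonneg (i := leftBits x))).2
  rw [glueMatrix_apply, hp, mul_one, Complex.mul_re, ← him]
  simp

theorem glueMatrix_trace_re [IsProbabilityMeasure ν]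
    {M : Matrix (Fin k → Bits A) (Fin k → Bits A) ℂ} (hM : M.PosSemidef) :
    (glueMatrix ΞA ΞB ν M N).trace.re = M.trace.re * N.trace.re := by
  simp only [Matrix.trace, Complex.re_sum, Matrix.diag_apply, glueMatrix_diag_re ΞA ΞB ν N hM]
  exact sum_left_mul_right (fun a => (M a a).re) fun b => (N b b).re

theorem moment_gluedEnsemble (k : ℕ) (SA : Measure (PureState A)) [IsProbabilityMeasure SA]
    (SB : Measure (PureState B)) [IsProbabilityMeasure SB] [IsProbabilityMeasure ν] :
    moment k (gluedEnsemble ΞA ΞB SA SB ν) =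
      glueMatrix ΞA ΞB ν (moment k SA) (moment k SB) := by
  ext x y
  have hc : Continuous fun φ : PureState (A ⊕ B) => ∏ j, φ.1 (x j) * star (φ.1 (y j)) := by
    fun_prop
  rw [moment_apply, gluedEnsemble, integral_map (measurable_glue ΞA ΞB).aemeasurable
    hc.aestronglyMeasurable, glueMatrix_apply, moment_apply, moment_apply, phaseMatrix,
    Matrix.of_apply, ← integral_prod_mul, ← integral_prod_mul]
  congr 1 with p
  rw [star_prod, ← Finset.prod_mul_distrib, ← Finset.prod_mul_distrib, ← Finset.prod_mul_distrib]
  refine Finset.prod_congr rfl fun j _ => ?_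
  simp only [applyPhase, tensorState, star_mul', leftBits, rightBits]
  ring

variable {ΞA ΞB ν M N} in
theorem IsTraceBounded.glueMatrix_left [IsProbabilityMeasure ν] {ε : ℝ} (hM : IsTraceBounded M ε)
    (hN : N.PosSemidef) (hN1 : N.trace.re = 1) : IsTraceBounded (glueMatrix ΞA ΞB ν M N) ε := by
  obtain ⟨P, P', hP, hP', rfl, h⟩ := hM
  refine ⟨_, _, glueMatrix_posSemidef ΞA ΞB ν hP hN, glueMatrix_posSemidef ΞA ΞB ν hP' hN,
    glueMatrix_sub_left .., ?_⟩
  rwa [glueMatrix_trace_re _ _ _ _ hP, glueMatrix_trace_re _ _ _ _ hP', hN1, mul_one, mul_one]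

variable {ΞA ΞB ν M N} in
theorem IsTraceBounded.glueMatrix_right [IsProbabilityMeasure ν] {ε : ℝ} (hN : IsTraceBounded N ε)
    (hM : M.PosSemidef) (hM1 : M.trace.re = 1) : IsTraceBounded (glueMatrix ΞA ΞB ν M N) ε := by
  obtain ⟨P, P', hP, hP', rfl, h⟩ := hN
  refine ⟨_, _, glueMatrix_posSemidef ΞA ΞB ν hM hP, glueMatrix_posSemidef ΞA ΞB ν hM hP',
    glueMatrix_sub_right .., ?_⟩
  rwa [glueMatrix_trace_re _ _ _ _ hM, glueMatrix_trace_re _ _ _ _ hM, hM1, one_mul, one_mul]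

theorem moment_trace_re {Q : Type} [Fintype Q] [DecidableEq Q] (k : ℕ) (S : Measure (PureState Q))
    [IsProbabilityMeasure S] : (moment k S).trace.re = 1 := by
  rw [Matrix.trace, Complex.re_sum]
  exact sum_moment_diag_re k S

/-- Tuples of bitstrings whose restrictions to `ΞA` are distinct, and whose restrictions to `ΞB`
are distinct. -/
def IsLocallyDistinct (x : Fin k → Bits (A ⊕ B)) : Prop :=
  Function.Injective (fun (j : Fin k) (q : ΞA) => leftBits x j q) ∧
    Function.Injective (fun (j : Fin k) (q : ΞB) => rightBits x j q)

variable {ΞA ΞB} {x y : Fin k → Bits (A ⊕ B)}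

theorem IsLocallyDistinct.injective (hx : IsLocallyDistinct ΞA ΞB x) : Function.Injective x := by
  intro i j hij
  refine hx.1 ?_
  simp only [leftBits, hij]

theorem IsLocallyDistinct.of_perm (hx : IsLocallyDistinct ΞA ΞB x) {σ τ : Equiv.Perm (Fin k)}
    (hl : leftBits y = leftBits x ∘ σ) (hr : rightBits y = rightBits x ∘ τ) :
    IsLocallyDistinct ΞA ΞB y := by
  rw [IsLocallyDistinct, hl, hr]
  exact ⟨hx.1.comp σ.injective, hx.2.comp τ.injective⟩

theorem IsLocallyDistinct.restrict_injective (hx : IsLocallyDistinct ΞA ΞB x) :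
    Function.Injective fun j => restrictBits ΞA ΞB (x j) := by
  intro i j hij
  refine hx.1 (funext fun q => ?_)
  exact congrFun hij (Sum.inl q)

/-- Equality of the restricted sets supplies a single permutation `π` acting on both halves at once.
Distinctness on `ΞA` forces `σ = π`, and distinctness on `ΞB` forces `τ = π`. -/
theorem IsLocallyDistinct.eq_comp_perm (hx : IsLocallyDistinct ΞA ΞB x)
    (hy : IsLocallyDistinct ΞA ΞB y) {σ τ : Equiv.Perm (Fin k)}
    (hl : leftBits y = leftBits x ∘ σ) (hr : rightBits y = rightBits x ∘ τ)
    (h : (Finset.univ.image fun j => restrictBits ΞA ΞB (x j)) =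
      Finset.univ.image fun j => restrictBits ΞA ΞB (y j)) : y = x ∘ σ := by
  obtain ⟨π, hπ⟩ := exists_perm_of_image_eq hx.restrict_injective hy.restrict_injective h
  have hσ (j : Fin k) : σ j = π j := hx.1 (funext fun q => by
    have h1 := congrFun (congrFun hπ j) (Sum.inl q)
    have h2 := congrFun (congrFun hl j) (q : A)
    exact h2.symm.trans h1)
  have hτ (j : Fin k) : τ j = π j := hx.2 (funext fun q => by
    have h1 := congrFun (congrFun hπ j) (Sum.inr q)
    have h2 := congrFun (congrFun hr j) (q : B)
    exact h2.symm.trans h1)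
  funext j q
  rcases q with a | b
  · exact congrFun (congrFun hl j) a
  · refine (congrFun (congrFun hr j) b).trans ?_
    rw [Function.comp_apply, hτ, ← hσ]
    rfl

/-- The matrix that relates two locally distinct tuples if they agree up to a permutation. -/
def distinctMatrix (k : ℕ) (ΞA : Finset A) (ΞB : Finset B)
    [DecidablePred (IsLocallyDistinct (k := k) ΞA ΞB)] :
    Matrix (Fin k → Bits (A ⊕ B)) (Fin k → Bits (A ⊕ B)) ℂ :=
  Matrix.of fun x y => if IsLocallyDistinct ΞA ΞB x ∧ IsLocallyDistinct ΞA ΞB y ∧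
    Finset.univ.image x = Finset.univ.image y then 1 else 0

theorem distinctMatrix_posSemidef [DecidablePred (IsLocallyDistinct (k := k) ΞA ΞB)] :
    (distinctMatrix k ΞA ΞB).PosSemidef := by
  -- Gram factorisation: each locally distinct tuple is sent to the basis vector of its set of
  -- entries.
  let V : Matrix (Finset (Bits (A ⊕ B))) (Fin k → Bits (A ⊕ B)) ℂ := Matrix.of fun s x =>
    if IsLocallyDistinct ΞA ΞB x ∧ Finset.univ.image x = s then 1 else 0
  have h : distinctMatrix k ΞA ΞB = Vᴴ * V := by
    ext x y
    simp only [distinctMatrix, V, Matrix.mul_apply, Matrix.conjTranspose_apply, Matrix.of_apply]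
    by_cases hx : IsLocallyDistinct ΞA ΞB x <;> by_cases hy : IsLocallyDistinct ΞA ΞB y <;>
      simp [hx, hy, eq_comm]
  rw [h]
  exact Matrix.posSemidef_conjTranspose_mul_self V

theorem sum_not_locallyDistinct_le [DecidablePred (IsLocallyDistinct (k := k) ΞA ΞB)]
    {m : (Fin k → Bits (A ⊕ B)) → ℝ} (hm : ∀ x, 0 ≤ m x) {ε : ℝ} (hε : 0 ≤ ε)
    (hA : ∀ i j, i ≠ j → ∑ x : Fin k → Bits (A ⊕ B),
      (if leftBits x i ∘ ((↑) : ΞA → A) = leftBits x j ∘ ((↑) : ΞA → A) then m x else 0) ≤ ε)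
    (hB : ∀ i j, i ≠ j → ∑ x : Fin k → Bits (A ⊕ B),
      (if rightBits x i ∘ ((↑) : ΞB → B) = rightBits x j ∘ ((↑) : ΞB → B) then m x else 0) ≤ ε) :
    ∑ x, (if IsLocallyDistinct ΞA ΞB x then 0 else m x) ≤ 2 * (k ^ 2 * ε) := by
  classical
  have h1 := sum_not_injective_le hm (fun x j => leftBits x j ∘ ((↑) : ΞA → A)) hε hA
  have h2 := sum_not_injective_le hm (fun x j => rightBits x j ∘ ((↑) : ΞB → B)) hε hB
  rw [two_mul]
  refine le_trans ?_ (add_le_add h1 h2)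
  rw [← Finset.sum_add_distrib]
  refine Finset.sum_le_sum fun x _ => ?_
  have hmx := hm x
  by_cases hx : IsLocallyDistinct ΞA ΞB x
  · rw [if_pos hx]
    refine add_nonneg ?_ ?_ <;> split_ifs <;> simp [hmx]
  · rw [if_neg hx]
    rw [IsLocallyDistinct, not_and_or] at hx
    rcases hx with hx | hx
    · rw [if_neg (c := Function.Injective fun j => leftBits x j ∘ ((↑) : ΞA → A)) hx]
      refine le_add_of_nonneg_right ?_
      split_ifs <;> simp [hmx]
    · rw [if_neg (c := Function.Injective fun j => rightBits x j ∘ ((↑) : ΞB → B)) hx]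
      refine le_add_of_nonneg_left ?_
      split_ifs <;> simp [hmx]

variable {ν}

theorem isTraceBounded_glue_haar [IsProbabilityMeasure ν] {ξ : ℕ} (hA : ΞA.card = ξ)
    (hB : ΞB.card = ξ) (hν : IsWiseIndependent (2 * k) ν) (hk : k ^ 2 < 2 ^ ξ) :
    IsTraceBounded (glueMatrix ΞA ΞB ν (moment k (haarEnsemble A)) (moment k (haarEnsemble B)) -
      moment k (haarEnsemble (A ⊕ B))) (16 * ((k : ℝ) ^ 2 / 2 ^ ξ)) := by
  classical
  set HA := moment k (haarEnsemble A) with hHA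
  set HB := moment k (haarEnsemble B) with hHB
  have hHAp : HA.PosSemidef := moment_posSemidef k _
  have hHBp : HB.PosSemidef := moment_posSemidef k _
  obtain ⟨pA, hpA⟩ := exists_moment_haar_eq A k
  obtain ⟨pB, hpB⟩ := exists_moment_haar_eq B k
  obtain ⟨p, hp⟩ := exists_moment_haar_eq (A ⊕ B) k
  -- Without this inequality no `2k` distinct inputs exist and the independence hypothesis is
  -- vacuous. It follows from `2k ≤ k ^ 2 + 1 ≤ 2 ^ ξ`.
  have hk2 : 2 * k ≤ Fintype.card (Bits (ΞA ⊕ ΞB)) := by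
    have h1 : Fintype.card (Bits (ΞA ⊕ ΞB)) = 2 ^ ξ * 2 ^ ξ := by
      simp [hA, hB, pow_add]
    have h2 : 2 * k ≤ 2 ^ ξ := by nlinarith [sq_nonneg ((k : ℤ) - 1)]
    rw [h1]
    exact h2.trans (Nat.le_mul_of_pos_right _ (by positivity))
  have hcA {i j : Fin k} (hij : i ≠ j) := sum_collision_moment_haar_le
    (Subtype.val_injective : Function.Injective ((↑) : ΞA → A)) hij
  have hcB {i j : Fin k} (hij : i ≠ j) := sum_collision_moment_haar_le
    (Subtype.val_injective : Function.Injective ((↑) : ΞB → B)) hij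
  simp only [Fintype.card_coe, hA, hB] at hcA hcB
  -- `4` from the block comparison, the outer `2` for the sides `A` and `B`, `k ^ 2` pairs, and `2 /
  -- 2 ^ ξ` for each collision.
  have h16 : 16 * ((k : ℝ) ^ 2 / 2 ^ ξ) = 4 * (2 * (k ^ 2 * (2 / 2 ^ ξ))) := by ring
  rw [h16]
  refine IsTraceBounded.of_proportional_block (IsLocallyDistinct ΞA ΞB)
    (T := distinctMatrix k ΞA ΞB) (c := pA * pB) (d := p)
    (glueMatrix_posSemidef ΞA ΞB ν hHAp hHBp) (moment_posSemidef k _) distinctMatrix_posSemidef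
    ?_ (moment_trace_re k _) ?_ ?_ ?_ ?_ ?_ ?_ ?_
  · rw [glueMatrix_trace_re _ _ _ _ hHAp, hHA, hHB, moment_trace_re, moment_trace_re, one_mul]
  · intro x y hy
    simp [distinctMatrix, hy]
  · intro x y hx hy
    by_cases him : Finset.univ.image x = Finset.univ.image y
    · obtain ⟨σ, rfl⟩ := exists_perm_of_image_eq hx.injective hy.injective him
      have hl : leftBits (x ∘ σ) = leftBits x ∘ σ := rfl
      have hr : rightBits (x ∘ σ) = rightBits x ∘ σ := rfl
      have hlx : Function.Injective (leftBits x) := fun i j hij => hx.1 (by simp only [hij])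
      have hrx : Function.Injective (rightBits x) := fun i j hij => hx.2 (by simp only [hij])
      rw [glueMatrix_apply, hl, hr, phaseMatrix_comp_perm, hHA, hHB, moment_comp_perm,
        moment_comp_perm, hpA _ hlx, hpB _ hrx]
      simp [distinctMatrix, hx, hy, him]
    · have hT : distinctMatrix k ΞA ΞB x y = 0 := by simp [distinctMatrix, him]
      rw [hT, mul_zero]
      by_contra hne
      rw [glueMatrix_apply] at hne
      obtain ⟨hne, h3⟩ := mul_ne_zero_iff.1 hne
      obtain ⟨h1, h2⟩ := mul_ne_zero_iff.1 hne
      obtain ⟨σ, hσ⟩ := exists_perm_of_moment_haar_ne_zero h1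
      obtain ⟨τ, hτ⟩ := exists_perm_of_moment_haar_ne_zero h2
      have h4 := hν.image_eq_of_integral_ne_zero hk2 hx.restrict_injective
        hy.restrict_injective h3
      have h5 := hx.eq_comp_perm hy hσ hτ h4
      refine him ?_
      rw [h5, ← Finset.image_image, Finset.image_univ_equiv]
  · intro x y hx hy
    by_contra hne
    rw [glueMatrix_apply] at hne
    obtain ⟨h1, h2⟩ := mul_ne_zero_iff.1 (left_ne_zero_of_mul hne)
    obtain ⟨σ, hσ⟩ := exists_perm_of_moment_haar_ne_zero h1
    obtain ⟨τ, hτ⟩ := exists_perm_of_moment_haar_ne_zero h2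
    exact hy (hx.of_perm hσ hτ)
  · intro x y hx hy
    by_cases him : Finset.univ.image x = Finset.univ.image y
    · obtain ⟨σ, rfl⟩ := exists_perm_of_image_eq hx.injective hy.injective him
      rw [moment_comp_perm, hp _ hx.injective]
      simp [distinctMatrix, hx, hy, him]
    · have hT : distinctMatrix k ΞA ΞB x y = 0 := by simp [distinctMatrix, him]
      rw [hT, mul_zero]
      by_contra hne
      obtain ⟨σ, rfl⟩ := exists_perm_of_moment_haar_ne_zero hne
      refine him ?_
      rw [← Finset.image_image, Finset.image_univ_equiv]
  · intro x y hx hy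
    by_contra hne
    obtain ⟨σ, rfl⟩ := exists_perm_of_moment_haar_ne_zero hne
    exact hy (hx.of_perm (σ := σ) (τ := σ) rfl rfl)
  · refine sum_not_locallyDistinct_le (fun x => ?_) (by positivity) (fun i j hij => ?_)
      fun i j hij => ?_
    · rw [glueMatrix_diag_re _ _ _ _ hHAp]
      exact mul_nonneg (moment_diag_re_nonneg k _ _) (moment_diag_re_nonneg k _ _)
    · have h := sum_left_mul_right (fun a : Fin k → Bits A =>
        if a i ∘ ((↑) : ΞA → A) = a j ∘ ((↑) : ΞA → A) then (HA a a).re else 0)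
        fun b => (HB b b).re
      simp_rw [glueMatrix_diag_re _ _ _ _ hHAp]
      simp only [ite_mul, zero_mul] at h
      rw [h, hHB, sum_moment_diag_re, mul_one]
      exact hcA hij
    · have h := sum_left_mul_right (fun a => (HA a a).re) (fun b : Fin k → Bits B =>
        if b i ∘ ((↑) : ΞB → B) = b j ∘ ((↑) : ΞB → B) then (HB b b).re else 0)
      simp_rw [glueMatrix_diag_re _ _ _ _ hHAp]
      simp only [mul_ite, mul_zero] at h
      rw [h, hHA, sum_moment_diag_re, one_mul]
      exact hcB hij
  · refine sum_not_locallyDistinct_le (moment_diag_re_nonneg k _) (by positivity)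
      (fun i j hij => ?_) fun i j hij => ?_
    · have h := sum_collision_moment_haar_le (Q := A ⊕ B)
        (Sum.inl_injective.comp (Subtype.val_injective (p := (· ∈ ΞA)))) hij
      rw [Fintype.card_coe, hA] at h
      exact h
    · have h := sum_collision_moment_haar_le (Q := A ⊕ B)
        (Sum.inr_injective.comp (Subtype.val_injective (p := (· ∈ ΞB)))) hij
      rw [Fintype.card_coe, hB] at h
      exact h

/-! ### Replacing the designs by Haar ensembles, and the final bound. -/

theorem isApproxStateDesign_iff {Q : Type} [Fintype Q] [DecidableEq Q] (k : ℕ) (ε : ℝ)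
    (S : Measure (PureState Q)) [IsProbabilityMeasure S] :
    IsApproxStateDesign k ε S ↔ IsTraceBounded (moment k S - moment k (haarEnsemble Q)) ε :=
  ⟨fun h => isTraceBounded_of_traceNorm_le
    ((moment_posSemidef k S).1.sub (moment_posSemidef k _).1) h, fun h => h.traceNorm_le⟩

theorem isApproxStateDesign_gluedEnsemble [IsProbabilityMeasure ν] {ξ : ℕ} (hA : ΞA.card = ξ)
    (hB : ΞB.card = ξ) (hν : IsWiseIndependent (2 * k) ν) (SA : Measure (PureState A))
    [IsProbabilityMeasure SA] (SB : Measure (PureState B)) [IsProbabilityMeasure SB] {εA εB : ℝ}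
    (hSA : IsApproxStateDesign k εA SA) (hSB : IsApproxStateDesign k εB SB) :
    IsApproxStateDesign k (εA + εB + 16 * ((k : ℝ) ^ 2 / 2 ^ ξ))
      (gluedEnsemble ΞA ΞB SA SB ν) := by
  rw [isApproxStateDesign_iff] at hSA hSB ⊢
  -- Hybrid argument: `SA` is replaced by Haar while `SB` is kept, then `SB` is replaced with Haar
  -- already on `A`.
  have h1 := hSA.glueMatrix_left (ΞA := ΞA) (ΞB := ΞB) (ν := ν) (moment_posSemidef k SB)
    (moment_trace_re k SB)
  have h2 := hSB.glueMatrix_right (ΞA := ΞA) (ΞB := ΞB) (ν := ν)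
    (moment_posSemidef k (haarEnsemble A)) (moment_trace_re k _)
  have h3 : IsTraceBounded (glueMatrix ΞA ΞB ν (moment k (haarEnsemble A))
      (moment k (haarEnsemble B)) - moment k (haarEnsemble (A ⊕ B)))
      (16 * ((k : ℝ) ^ 2 / 2 ^ ξ)) := by
    by_cases hk : k ^ 2 < 2 ^ ξ
    · exact isTraceBounded_glue_haar hA hB hν hk
    -- Here `k ^ 2 / 2 ^ ξ ≥ 1`, and the trivial bound `2` for two unit-trace positive matrices is
    -- enough.
    · have hkr : (2 : ℝ) ^ ξ ≤ (k : ℝ) ^ 2 := by exact_mod_cast not_lt.1 hk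
      have hge : 1 ≤ (k : ℝ) ^ 2 / 2 ^ ξ := (one_le_div (by positivity)).2 hkr
      have hHA := moment_posSemidef k (haarEnsemble A)
      refine (IsTraceBounded.sub_of_posSemidef (glueMatrix_posSemidef ΞA ΞB ν hHA
        (moment_posSemidef k _)) (moment_posSemidef k _)).mono ?_
      rw [glueMatrix_trace_re _ _ _ _ hHA, moment_trace_re, moment_trace_re, moment_trace_re]
      linarith
  rw [moment_gluedEnsemble]
  convert (h1.add h2).add h3 using 1
  rw [glueMatrix_sub_left, glueMatrix_sub_right]
  abel

end Glue

end QDesign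

theorem mainTheorem10 :
    ∃ C : ℝ, 0 < C ∧
      ∀ (k ξ : ℕ) (A B : Type) [Fintype A] [DecidableEq A] [Fintype B] [DecidableEq B]
        (ΞA : Finset A) (ΞB : Finset B), ΞA.card = ξ → ΞB.card = ξ →
      ∀ (SA : Measure (QDesign.PureState A)) [IsProbabilityMeasure SA]
        (SB : Measure (QDesign.PureState B)) [IsProbabilityMeasure SB]
        (ν : Measure (QDesign.Bits (ΞA ⊕ ΞB) → Bool)) [IsProbabilityMeasure ν],
        QDesign.IsWiseIndependent (2 * k) ν →
      ∀ εA εB : ℝ,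
        QDesign.IsApproxStateDesign k εA SA → QDesign.IsApproxStateDesign k εB SB →
        QDesign.IsApproxStateDesign k (εA + εB + C * ((k : ℝ) ^ 2 / 2 ^ ξ))
          (QDesign.gluedEnsemble ΞA ΞB SA SB ν) := by
  refine ⟨16, by norm_num, ?_⟩
  intro k ξ A B _ _ _ _ ΞA ΞB hA hB SA _ SB _ ν _ hν εA εB hSA hSB
  exact QDesign.isApproxStateDesign_gluedEnsemble hA hB hν SA SB hSA hSB
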